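/- Let $Z=(Z_1,Z_2)$ be a piecewise quadratic Kolmogorov system separated by a straight line, that is, $$Z_i:\quad \dot x = x(a_i+b_ix+c_iy),\qquad \dot y = y(d_i+e_ix+f_iy)\qquad\text{on } \Sigma_i=\{(x,y)\in\mathbb R^2:(-1)^ih(x,y)>0\},\quad i=1,2,$$ with real coefficients, where $h$ is a polynomial of degree one and $\Sigma=\{h=0\}$. Let $(x_0,y_0)\in\Sigma$ be a $CC$-equilibrium, i.e. a common equilibrium of $Z_1$ and $Z_2$ at which both Jacobian matrices have nonzero purely imaginary eigenvalues, and suppose that it is monodromic, i.e. that the trajectories of $Z$ near $(x_0,y_0)$ cross $\Sigma$ and turn around $(x_0,y_0)$. Let $D_1,D_2$ be real numbers with $\det \mathrm{Jac}\, Z_i(x_0,y_0)=D_i^2$ for $i=1,2$. Call $(x_0,y_0)$ a center if all trajectories of $Z$ near it, other than the point itself, are periodic orbits surrounding it. Then: (i) If $h(x,y)=xy_0-yx_0$, then $Z$ has a center at $(x_0,y_0)$ if and only if $$D_1^2D_2^2(b_1e_2-b_2e_1)-x_0^2D_1^2b_2e_1(b_2-e_2)^2+x_0^2D_2^2b_1e_2(b_1-e_1)^2=0.$$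 (ii) If $h(x,y)=y-y_0$, then $Z$ has a center at $(x_0,y_0)$ if and only if $$D_1^2b_2^2-D_1^2b_2e_2-D_2^2b_1^2+D_2^2b_1e_1=0.$$ (iii) If $h(x,y)=x-x_0$, then $Z$ has a center at $(x_0,y_0)$ if and only if $$D_1^2D_2^2(b_1e_2-b_2e_1)-x_0^2D_1^2b_2^2e_1(b_2-e_2)+x_0^2D_2^2b_1^2e_2(b_1-e_1)=0.$$ -/

import Mathlib

open Set Filter Topology

/-- The coefficients of a planar quadratic Kolmogorov system
`x' = x (a + b x + c y)`, `y' = y (d + e x + f y)`. -/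
structure KolmogorovSystem where
  a : ℝ
  b : ℝ
  c : ℝ
  d : ℝ
  e : ℝ
  f : ℝ

namespace KolmogorovSystem

/-- The vector field of a quadratic Kolmogorov system. -/
def field (S : KolmogorovSystem) (q : ℝ × ℝ) : ℝ × ℝ :=
  (q.1 * (S.a + S.b * q.1 + S.c * q.2), q.2 * (S.d + S.e * q.1 + S.f * q.2))

/-- The Jacobian matrix (of partial derivatives) of the vector field at `q`. -/
noncomputable def jac (S : KolmogorovSystem) (q : ℝ × ℝ) : Matrix (Fin 2) (Fin 2) ℝ :=
  !![deriv (fun x => (S.field (x, q.2)).1) q.1, deriv (fun y => (S.field (q.1, y)).1) q.2;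
     deriv (fun x => (S.field (x, q.2)).2) q.1, deriv (fun y => (S.field (q.1, y)).2) q.2]

/-- `p` is an equilibrium of the system at which the Jacobian matrix has nonzero purely imaginary
eigenvalues. -/
def IsLinearCenter (S : KolmogorovSystem) (p : ℝ × ℝ) : Prop :=
  S.field p = 0 ∧
    ∀ l ∈ spectrum ℂ ((S.jac p).map (algebraMap ℝ ℂ)), l.re = 0 ∧ l.im ≠ 0

end KolmogorovSystem

/-- The class `𝒦₂`: two quadratic Kolmogorov systems `Z₁`, `Z₂`, and a polynomial
`h (x, y) = α x + β y + γ` of degree one whose zero set is the separation line. -/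
structure PiecewiseKolmogorov where
  Z₁ : KolmogorovSystem
  Z₂ : KolmogorovSystem
  α : ℝ
  β : ℝ
  γ : ℝ
  degree_one : α ≠ 0 ∨ β ≠ 0

namespace PiecewiseKolmogorov

/-- The degree one polynomial defining the separation line. -/
def h (Z : PiecewiseKolmogorov) (x y : ℝ) : ℝ := Z.α * x + Z.β * y + Z.γ

/-- The separation line `Σ = {h = 0}`. -/
def sepLine (Z : PiecewiseKolmogorov) : Set (ℝ × ℝ) := {q | Z.h q.1 q.2 = 0}

/-- The region `Σ₁ = {-h > 0}`, where `Z` is given by `Z₁`. -/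
def region₁ (Z : PiecewiseKolmogorov) : Set (ℝ × ℝ) := {q | 0 < - Z.h q.1 q.2}

/-- The region `Σ₂ = {h > 0}`, where `Z` is given by `Z₂`. -/
def region₂ (Z : PiecewiseKolmogorov) : Set (ℝ × ℝ) := {q | 0 < Z.h q.1 q.2}

/-- `c` is a crossing trajectory of `Z` on the time interval `[0, T]`: it is continuous, it solves
`q' = Z₁ q` while it is in `Σ₁` and `q' = Z₂ q` while it is in `Σ₂`, and it meets the separation
line at finitely many times only (in particular it does not slide along the line). -/
def IsTrajectory (Z : PiecewiseKolmogorov) (T : ℝ) (c : ℝ → ℝ × ℝ) : Prop :=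
  ContinuousOn c (Icc 0 T) ∧
  (∀ t ∈ Icc 0 T, c t ∈ Z.region₁ → HasDerivWithinAt c (Z.Z₁.field (c t)) (Icc 0 T) t) ∧
  (∀ t ∈ Icc 0 T, c t ∈ Z.region₂ → HasDerivWithinAt c (Z.Z₂.field (c t)) (Icc 0 T) t) ∧
  {t | t ∈ Icc 0 T ∧ c t ∈ Z.sepLine}.Finite

/-- On `[0, T]` the curve `c` avoids `p` and makes exactly one full turn around `p`, clockwise or
counter-clockwise, in terms of a continuous polar angle `θ` about `p`. -/
def TurnsOnceAround (p : ℝ × ℝ) (T : ℝ) (c : ℝ → ℝ × ℝ) : Prop :=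
  ∃ r θ : ℝ → ℝ, ContinuousOn θ (Icc 0 T) ∧
    (∀ t ∈ Icc 0 T, 0 < r t ∧
      c t = (p.1 + r t * Real.cos (θ t), p.2 + r t * Real.sin (θ t))) ∧
    |θ T - θ 0| = 2 * Real.pi

/-- `p` is monodromic: the trajectories near `p` rotate around `p`. Given a neighbourhood `V` of
`p`, from every point `q ≠ p` close to `p` starts a trajectory that makes a full turn around `p`
inside `V` (so that the return map to each half of the separation line at `p` is defined). -/
def IsMonodromic (Z : PiecewiseKolmogorov) (p : ℝ × ℝ) : Prop :=
  ∀ V ∈ 𝓝 p, ∀ᶠ q in 𝓝[≠] p, ∃ (T : ℝ) (c : ℝ → ℝ × ℝ), 0 < T ∧ Z.IsTrajectory T c ∧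
    c 0 = q ∧ (∀ t ∈ Icc 0 T, c t ∈ V) ∧ TurnsOnceAround p T c

/-- `p` is a center: the trajectories near `p` are periodic orbits around `p`. Given a
neighbourhood `V` of `p`, through every point `q ≠ p` close to `p` passes a closed trajectory
(hence a periodic one, the system being autonomous) that surrounds `p` inside `V`. -/
def IsCenter (Z : PiecewiseKolmogorov) (p : ℝ × ℝ) : Prop :=
  ∀ V ∈ 𝓝 p, ∀ᶠ q in 𝓝[≠] p, ∃ (T : ℝ) (c : ℝ → ℝ × ℝ), 0 < T ∧ Z.IsTrajectory T c ∧
    c 0 = q ∧ c T = q ∧ (∀ t ∈ Icc 0 T, c t ∈ V) ∧ TurnsOnceAround p T c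

/-- `p` is a `CC`-equilibrium on the separation line: a common equilibrium of `Z₁` and `Z₂` at
which both Jacobian matrices have nonzero purely imaginary eigenvalues. -/
def IsCCEquilibrium (Z : PiecewiseKolmogorov) (p : ℝ × ℝ) : Prop :=
  p ∈ Z.sepLine ∧ Z.Z₁.IsLinearCenter p ∧ Z.Z₂.IsLinearCenter p

end PiecewiseKolmogorov

/-!
At an equilibrium `p` of a quadratic Kolmogorov system with purely imaginary eigenvalues both
coordinates are nonzero and the trace vanishes, so `x ^ (A - 1) * y ^ (B - 1)` with
`A = KolmogorovSystem.expX`, `B = KolmogorovSystem.expY` is an integrating factor. The resulting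
first integral (`KolmogorovSystem.firstIntegral`) has a definite second derivative at `p`, hence
is strictly monotone along the rays from `p`. Each of the three lines has a coordinate `u`, with
`u = 1` at `p`, in which the restriction of the first integral to the line is a constant multiple
of `linePrimitive γ u`, the primitive of `u ^ (γ - 1) * (u - 1)`, where `γ` is `A + B`, `A`, `B`
for the line through the origin, the horizontal and the vertical line respectively. The half-return
map of each system to the line thus depends on the single number `γ`, and
`PiecewiseKolmogorov.isCenter_iff_exponent_eq` shows that `p` is a center if and only if
`γ₁ = γ₂`. With the denominators cleared this is the polynomial condition.

* If `γ₁ = γ₂`, multiples of the two first integrals agree on the line. Together they give a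
  function that is constant along trajectories and injective on rays, so that a trajectory that
  has made a full turn, which exists because `p` is monodromic, is closed.
* If `γ₁ ≠ γ₂`, then `linePrimitive γ₂ - linePrimitive γ₁` is strictly monotone
  (`strictMonoOn_linePrimitive_sub`). Arcs of either system cross from one half-line at `p` to the
  other, in a direction fixed by the normal velocity. So the value of `linePrimitive γ₂` at the
  successive points on the line is unchanged along the arcs of `Z₂` and moves in one fixed
  direction along those of `Z₁`, and no trajectory closes up.
-/

/-! ### Primitives of powers -/

/-- The primitive of `t ↦ t ^ (γ - 1)` on `(0, ∞)` that vanishes at `1`. -/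
noncomputable def powPrimitive (γ t : ℝ) : ℝ :=
  if γ = 0 then Real.log t else (t ^ γ - 1) / γ

lemma powPrimitive_one (γ : ℝ) : powPrimitive γ 1 = 0 := by
  simp [powPrimitive]

lemma rpow_eq_one_add_mul_powPrimitive (γ t : ℝ) : t ^ γ = 1 + γ * powPrimitive γ t := by
  unfold powPrimitive
  split_ifs with h
  · simp [h]
  · field_simp; ring

lemma hasDerivAt_powPrimitive (γ : ℝ) {t : ℝ} (ht : 0 < t) :
    HasDerivAt (powPrimitive γ) (t ^ (γ - 1)) t := by
  by_cases h : γ = 0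
  · have : powPrimitive γ = Real.log := by ext; simp [powPrimitive, h]
    rw [this, h, zero_sub, Real.rpow_neg_one]
    exact Real.hasDerivAt_log ht.ne'
  · have : powPrimitive γ = fun t => (t ^ γ - 1) / γ := by ext; simp [powPrimitive, h]
    rw [this]
    exact (((Real.hasDerivAt_rpow_const (p := γ) (Or.inl ht.ne')).sub_const 1).div_const
      γ).congr_deriv (mul_div_cancel_left₀ _ h)

/-- The primitive of `u ↦ u ^ (γ - 1) * (u - 1)` on `(0, ∞)` that vanishes at `1`. -/
noncomputable def linePrimitive (γ u : ℝ) : ℝ := powPrimitive (γ + 1) u - powPrimitive γ u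

lemma linePrimitive_one (γ : ℝ) : linePrimitive γ 1 = 0 := by
  simp [linePrimitive, powPrimitive_one]

lemma hasDerivAt_linePrimitive (γ : ℝ) {u : ℝ} (hu : 0 < u) :
    HasDerivAt (linePrimitive γ) (u ^ (γ - 1) * (u - 1)) u := by
  refine ((hasDerivAt_powPrimitive (γ + 1) hu).sub (hasDerivAt_powPrimitive γ hu)).congr_deriv ?_
  rw [add_sub_cancel_right, Real.rpow_sub_one hu.ne']
  field_simp

/-- The functions `linePrimitive γ` separate the exponents: two points at the same level of
`linePrimitive γ₁` are at different levels of `linePrimitive γ₂`. -/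
lemma strictMonoOn_linePrimitive_sub {γ₁ γ₂ : ℝ} (h : γ₁ < γ₂) :
    StrictMonoOn (fun u => linePrimitive γ₂ u - linePrimitive γ₁ u) (Ioi 0) := by
  have hd : ∀ u : ℝ, 0 < u → HasDerivAt (fun u => linePrimitive γ₂ u - linePrimitive γ₁ u)
      ((u ^ (γ₂ - 1) - u ^ (γ₁ - 1)) * (u - 1)) u := fun u hu =>
    ((hasDerivAt_linePrimitive γ₂ hu).sub (hasDerivAt_linePrimitive γ₁ hu)).congr_deriv (by ring)
  have h₁ : StrictMonoOn (fun u => linePrimitive γ₂ u - linePrimitive γ₁ u) (Ioc 0 1) := by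
    refine strictMonoOn_of_deriv_pos (convex_Ioc 0 1)
      (fun u hu => (hd u hu.1).continuousAt.continuousWithinAt) fun u hu => ?_
    rw [interior_Ioc] at hu
    rw [(hd u hu.1).deriv]
    exact mul_pos_of_neg_of_neg
      (sub_neg.2 (Real.rpow_lt_rpow_of_exponent_gt hu.1 hu.2 (by linarith))) (sub_neg.2 hu.2)
  have h₂ : StrictMonoOn (fun u => linePrimitive γ₂ u - linePrimitive γ₁ u) (Ici 1) := by
    refine strictMonoOn_of_deriv_pos (convex_Ici 1)
      (fun u hu => (hd u (one_pos.trans_le hu)).continuousAt.continuousWithinAt) fun u hu => ?_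
    rw [interior_Ici] at hu
    rw [(hd u (one_pos.trans hu)).deriv]
    exact mul_pos (sub_pos.2 (Real.rpow_lt_rpow_of_exponent_lt hu (by linarith))) (sub_pos.2 hu)
  rw [← Ioc_union_Ici_eq_Ioi one_pos]
  exact h₁.union h₂ (isGreatest_Ioc one_pos) isLeast_Ici

/-! ### One-variable lemmas -/

lemma eq_of_hasDerivAt_zero_off_finite {f : ℝ → ℝ} {a b : ℝ} {s : Set ℝ} (hab : a ≤ b)
    (hs : s.Finite) (hc : ContinuousOn f (Icc a b))
    (hd : ∀ t ∈ Ioo a b \ s, HasDerivAt f 0 t) : f a = f b := by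
  have := MeasureTheory.integral_eq_of_hasDerivAt_off_countable_of_le f (fun _ => 0) hab
    hs.countable hc hd (by simp)
  simp at this
  linarith

lemma deriv_left_nonneg_of_pos {f f' : ℝ → ℝ} {a b : ℝ} (hab : a < b)
    (hc : ContinuousOn f (Icc a b)) (hc' : ContinuousOn f' (Icc a b))
    (hd : ∀ t ∈ Ioo a b, HasDerivAt f (f' t) t) (ha : f a = 0) (hpos : ∀ t ∈ Ioo a b, 0 < f t) :
    0 ≤ f' a := by
  have hm : a ∈ Icc a b := left_mem_Icc.2 hab.le
  have h0 : HasDerivWithinAt f (f' a) (Ici a) a := by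
    refine hasDerivWithinAt_Ici_of_tendsto_deriv (s := Ioo a b)
      (fun t ht => (hd t ht).differentiableAt.differentiableWithinAt)
      ((hc a hm).mono Ioo_subset_Icc_self) (Ioo_mem_nhdsGT hab) ?_
    have h1 : Tendsto f' (𝓝[>] a) (𝓝 (f' a)) := by
      rw [← nhdsWithin_Ioo_eq_nhdsGT hab]
      exact (hc' a hm).mono Ioo_subset_Icc_self
    refine h1.congr' ?_
    filter_upwards [Ioo_mem_nhdsGT hab] with t ht using (hd t ht).deriv.symm
  have h2 := (hasDerivWithinAt_iff_tendsto_slope' self_notMem_Ioi).1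
    (h0.mono Ioi_subset_Ici_self)
  refine ge_of_tendsto h2 ?_
  filter_upwards [Ioo_mem_nhdsGT hab] with t ht
  rw [slope_def_field, ha, sub_zero]
  exact (div_pos (hpos t ht) (sub_pos.2 ht.1)).le

lemma deriv_right_nonpos_of_pos {f f' : ℝ → ℝ} {a b : ℝ} (hab : a < b)
    (hc : ContinuousOn f (Icc a b)) (hc' : ContinuousOn f' (Icc a b))
    (hd : ∀ t ∈ Ioo a b, HasDerivAt f (f' t) t) (hb : f b = 0) (hpos : ∀ t ∈ Ioo a b, 0 < f t) :
    f' b ≤ 0 := by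
  have hI : ∀ t ∈ Icc (-b) (-a), -t ∈ Icc a b := fun t ht =>
    ⟨by linarith [ht.2], by linarith [ht.1]⟩
  have hO : ∀ t ∈ Ioo (-b) (-a), -t ∈ Ioo a b := fun t ht =>
    ⟨by linarith [ht.2], by linarith [ht.1]⟩
  have := deriv_left_nonneg_of_pos (f := fun t => f (-t)) (f' := fun t => -f' (-t))
    (neg_lt_neg hab) (hc.comp continuousOn_neg hI) (hc'.comp continuousOn_neg hI).neg
    (fun t ht => ((hd _ (hO t ht)).comp t (hasDerivAt_neg t)).congr_deriv (by ring))
    (by simpa using hb)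
    (fun t ht => hpos _ (hO t ht))
  simpa using this

/-! ### Arcs, closed trajectories and first integrals -/

namespace KolmogorovSystem

lemma continuous_field (S : KolmogorovSystem) : Continuous S.field := by
  unfold field; fun_prop

end KolmogorovSystem

namespace PiecewiseKolmogorov

variable {Z : PiecewiseKolmogorov}

/-- `H` is a first integral of `S` on `U` that is strictly monotone along the rays from `p`, and
the coordinate `u` along the separation line (equal to `1` exactly at `p`) puts the restriction
of `H` to the line into the normal form `κ * linePrimitive γ u`, while `S` crosses the line with
normal velocity of the sign of `μ * (u - 1)`. -/
structure IsAdaptedIntegral (Z : PiecewiseKolmogorov) (S : KolmogorovSystem) (p : ℝ × ℝ)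
    (u : ℝ × ℝ → ℝ) (U : Set (ℝ × ℝ)) (γ κ μ : ℝ) (H : ℝ × ℝ → ℝ) : Prop where
  hasFDerivAt : ∀ q ∈ U, ∃ L : ℝ × ℝ →L[ℝ] ℝ, HasFDerivAt H L q ∧ L (S.field q) = 0
  ray : ∃ k : ℝ, ∀ v : ℝ × ℝ, ∀ r₁ r₂ : ℝ, v ≠ 0 → 0 < r₁ → r₁ < r₂ → p + r₂ • v ∈ U →
    k * H (p + r₁ • v) < k * H (p + r₂ • v)
  coord_pos : ∀ q ∈ U, 0 < u q
  coord_ne_one : ∀ q ∈ U, q ∈ Z.sepLine → q ≠ p → u q ≠ 1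
  eq_on_line : ∀ q ∈ U, q ∈ Z.sepLine → H q = κ * linePrimitive γ (u q)
  normal_velocity : ∀ q ∈ U, q ∈ Z.sepLine → ∃ w : ℝ, 0 < w ∧
    Z.α * (S.field q).1 + Z.β * (S.field q).2 = μ * w * (u q - 1)
  κ_ne_zero : κ ≠ 0
  μ_ne_zero : μ ≠ 0

lemma IsAdaptedIntegral.mono {S : KolmogorovSystem} {p : ℝ × ℝ} {u : ℝ × ℝ → ℝ}
    {U V : Set (ℝ × ℝ)} {γ κ μ : ℝ} {H : ℝ × ℝ → ℝ}
    (h : Z.IsAdaptedIntegral S p u U γ κ μ H) (hV : V ⊆ U) :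
    Z.IsAdaptedIntegral S p u V γ κ μ H where
  hasFDerivAt q hq := h.hasFDerivAt q (hV hq)
  ray := h.ray.imp fun _ hk v r₁ r₂ hv h₁ h₂ hq => hk v r₁ r₂ hv h₁ h₂ (hV hq)
  coord_pos q hq := h.coord_pos q (hV hq)
  coord_ne_one q hq := h.coord_ne_one q (hV hq)
  eq_on_line q hq := h.eq_on_line q (hV hq)
  normal_velocity q hq := h.normal_velocity q (hV hq)
  κ_ne_zero := h.κ_ne_zero
  μ_ne_zero := h.μ_ne_zero

lemma IsAdaptedIntegral.hasDerivAt_comp {S : KolmogorovSystem} {p : ℝ × ℝ} {u : ℝ × ℝ → ℝ}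
    {U : Set (ℝ × ℝ)} {γ κ μ : ℝ} {H : ℝ × ℝ → ℝ}
    (h : Z.IsAdaptedIntegral S p u U γ κ μ H) {c : ℝ → ℝ × ℝ} {t : ℝ} (ht : c t ∈ U)
    (hc : HasDerivAt c (S.field (c t)) t) : HasDerivAt (fun s => H (c s)) 0 t := by
  obtain ⟨L, hL, h0⟩ := h.hasFDerivAt _ ht
  exact (hL.comp_hasDerivAt t hc).congr_deriv h0

lemma IsAdaptedIntegral.continuousOn {S : KolmogorovSystem} {p : ℝ × ℝ} {u : ℝ × ℝ → ℝ}
    {U : Set (ℝ × ℝ)} {γ κ μ : ℝ} {H : ℝ × ℝ → ℝ}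
    (h : Z.IsAdaptedIntegral S p u U γ κ μ H) : ContinuousOn H U := fun q hq => by
  obtain ⟨L, hL, -⟩ := h.hasFDerivAt q hq
  exact hL.continuousAt.continuousWithinAt

lemma continuous_h : Continuous fun q : ℝ × ℝ => Z.h q.1 q.2 := by
  unfold h; fun_prop

/-- An arc of an orbit between two points of the separation line, on the side where `σ * h > 0`,
joins the two half-lines at `p` in the direction given by the normal velocity, and its endpoints
lie on the same level of the first integral. -/
lemma IsAdaptedIntegral.arc {S : KolmogorovSystem} {p : ℝ × ℝ} {u : ℝ × ℝ → ℝ}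
    {U : Set (ℝ × ℝ)} {γ κ μ : ℝ} {H : ℝ × ℝ → ℝ}
    (hH : Z.IsAdaptedIntegral S p u U γ κ μ H) {c : ℝ → ℝ × ℝ} {s t σ : ℝ} (hst : s < t)
    (hcont : ContinuousOn c (Icc s t)) (hU : ∀ r ∈ Icc s t, c r ∈ U ∧ c r ≠ p)
    (hd : ∀ r ∈ Ioo s t, HasDerivAt c (S.field (c r)) r)
    (hσ : ∀ r ∈ Ioo s t, 0 < σ * Z.h (c r).1 (c r).2)
    (hs : c s ∈ Z.sepLine) (ht : c t ∈ Z.sepLine) :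
    0 < σ * μ * (u (c s) - 1) ∧ σ * μ * (u (c t) - 1) < 0 ∧
      linePrimitive γ (u (c s)) = linePrimitive γ (u (c t)) := by
  have hσ0 : σ ≠ 0 := by
    rintro rfl
    simpa using hσ ((s + t) / 2) ⟨by linarith, by linarith⟩
  have hms : s ∈ Icc s t := left_mem_Icc.2 hst.le
  have hmt : t ∈ Icc s t := right_mem_Icc.2 hst.le
  have hf : ContinuousOn (fun r => σ * Z.h (c r).1 (c r).2) (Icc s t) :=
    (continuous_h.comp_continuousOn hcont).const_smul σ
  have hX : ContinuousOn (fun r => S.field (c r)) (Icc s t) :=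
    S.continuous_field.comp_continuousOn hcont
  have hf' : ContinuousOn
      (fun r => σ * (Z.α * (S.field (c r)).1 + Z.β * (S.field (c r)).2)) (Icc s t) := by
    fun_prop
  have hfd : ∀ r ∈ Ioo s t, HasDerivAt (fun r => σ * Z.h (c r).1 (c r).2)
      (σ * (Z.α * (S.field (c r)).1 + Z.β * (S.field (c r)).2)) r := fun r hr => by
    have h1 := (hasFDerivAt_fst (𝕜 := ℝ) (p := c r)).comp_hasDerivAt r (hd r hr)
    have h2 := (hasFDerivAt_snd (𝕜 := ℝ) (p := c r)).comp_hasDerivAt r (hd r hr)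
    exact (((h1.const_mul Z.α).add (h2.const_mul Z.β)).add_const Z.γ).const_mul σ
  have h1 := deriv_left_nonneg_of_pos hst hf hf' hfd
    (by simp only [show Z.h (c s).1 (c s).2 = 0 from hs, mul_zero]) hσ
  have h2 := deriv_right_nonpos_of_pos hst hf hf' hfd
    (by simp only [show Z.h (c t).1 (c t).2 = 0 from ht, mul_zero]) hσ
  have hne : ∀ r ∈ Icc s t, c r ∈ Z.sepLine → σ * μ * (u (c r) - 1) ≠ 0 := fun r hr hl =>
    mul_ne_zero (mul_ne_zero hσ0 hH.μ_ne_zero)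
      (sub_ne_zero.2 (hH.coord_ne_one _ (hU r hr).1 hl (hU r hr).2))
  obtain ⟨w, hw, hws⟩ := hH.normal_velocity _ (hU s hms).1 hs
  obtain ⟨w', hw', hwt⟩ := hH.normal_velocity _ (hU t hmt).1 ht
  simp only [hws] at h1
  simp only [hwt] at h2
  refine ⟨lt_of_le_of_ne ?_ (hne s hms hs).symm, lt_of_le_of_ne ?_ (hne t hmt ht), ?_⟩
  · by_contra! hcon
    nlinarith [mul_neg_of_pos_of_neg hw hcon]
  · by_contra! hcon
    nlinarith [mul_pos hw' hcon]
  · have := eq_of_hasDerivAt_zero_off_finite (f := fun r => H (c r)) hst.le finite_empty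
      (hH.continuousOn.comp hcont fun r hr => (hU r hr).1)
      (fun r hr => hH.hasDerivAt_comp (hU r (Ioo_subset_Icc_self hr.1)).1 (hd r hr.1))
    simp only [hH.eq_on_line _ (hU s hms).1 hs, hH.eq_on_line _ (hU t hmt).1 ht] at this
    exact mul_left_cancel₀ hH.κ_ne_zero this

/-- After each time on the separation line there is a next one, and in between the trajectory
stays in one of the two regions. -/
lemma IsTrajectory.exists_next {T : ℝ} {c : ℝ → ℝ × ℝ} (hc : Z.IsTrajectory T c)
    (hT : c T ∈ Z.sepLine) {s : ℝ} (hs : s ∈ Icc 0 T) (hsT : s < T) :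
    ∃ t ∈ Icc 0 T, s < t ∧ c t ∈ Z.sepLine ∧
      ((∀ r ∈ Ioo s t, 0 < (-1) * Z.h (c r).1 (c r).2 ∧
          HasDerivAt c (Z.Z₁.field (c r)) r) ∨
        (∀ r ∈ Ioo s t, 0 < 1 * Z.h (c r).1 (c r).2 ∧
          HasDerivAt c (Z.Z₂.field (c r)) r)) := by
  obtain ⟨hcont, hd₁, hd₂, hfin⟩ := hc
  have hfin' : ({t | t ∈ Icc 0 T ∧ c t ∈ Z.sepLine} ∩ Ioi s).Finite := hfin.inter_of_left _
  obtain ⟨t, ⟨⟨htI, htl⟩, hst⟩, hmin⟩ := hfin'.exists_minimal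
    ⟨T, ⟨⟨hs.1.trans hsT.le, le_rfl⟩, hT⟩, hsT⟩
  have hIcc : ∀ r ∈ Ioo s t, r ∈ Icc 0 T := fun r hr =>
    ⟨hs.1.trans hr.1.le, hr.2.le.trans htI.2⟩
  have hne : ∀ r ∈ Ioo s t, Z.h (c r).1 (c r).2 ≠ 0 := fun r hr h0 =>
    absurd (hmin ⟨⟨hIcc r hr, h0⟩, hr.1⟩ hr.2.le) (not_le.2 hr.2)
  have hf : ContinuousOn (fun r => Z.h (c r).1 (c r).2) (Ioo s t) :=
    continuous_h.comp_continuousOn (hcont.mono hIcc)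
  have hnhds : ∀ r ∈ Ioo s t, Icc 0 T ∈ 𝓝 r := fun r hr =>
    Icc_mem_nhds (hs.1.trans_lt hr.1) (hr.2.trans_le htI.2)
  refine ⟨t, htI, hst, htl, ?_⟩
  by_cases hex : ∃ r₀ ∈ Ioo s t, 0 < Z.h (c r₀).1 (c r₀).2
  · obtain ⟨r₀, hr₀, hpos⟩ := hex
    refine Or.inr fun r hr => ?_
    have hr' : 0 < Z.h (c r).1 (c r).2 := by
      by_contra! hle
      obtain ⟨x, hx, hx0⟩ := isPreconnected_Ioo.intermediate_value hr hr₀ hf ⟨hle, hpos.le⟩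
      exact hne x hx hx0
    exact ⟨by simpa using hr', (hd₂ r (hIcc r hr) hr').hasDerivAt (hnhds r hr)⟩
  · push Not at hex
    refine Or.inl fun r hr => ?_
    have hr' : 0 < -Z.h (c r).1 (c r).2 :=
      neg_pos.2 (lt_of_le_of_ne (hex r hr) (hne r hr))
    exact ⟨by simpa using hr', (hd₁ r (hIcc r hr) hr').hasDerivAt (hnhds r hr)⟩

lemma TurnsOnceAround.ne {p : ℝ × ℝ} {T : ℝ} {c : ℝ → ℝ × ℝ} (h : TurnsOnceAround p T c)
    {t : ℝ} (ht : t ∈ Icc 0 T) : c t ≠ p := by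
  obtain ⟨r, θ, -, hrc, -⟩ := h
  obtain ⟨hr, hc⟩ := hrc t ht
  intro h
  rw [h, Prod.ext_iff] at hc
  have h1 : Real.cos (θ t) = 0 := by
    have : r t * Real.cos (θ t) = 0 := by simpa using hc.1
    exact (mul_eq_zero.1 this).resolve_left hr.ne'
  have h2 : Real.sin (θ t) = 0 := by
    have : r t * Real.sin (θ t) = 0 := by simpa using hc.2
    exact (mul_eq_zero.1 this).resolve_left hr.ne'
  have := Real.sin_sq_add_cos_sq (θ t)
  simp [h1, h2] at this

section Center

variable {p : ℝ × ℝ} {u : ℝ × ℝ → ℝ} {U : Set (ℝ × ℝ)} {γ₁ γ₂ κ₁ κ₂ μ₁ μ₂ : ℝ}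
  {H₁ H₂ : ℝ × ℝ → ℝ}

/-- Over a closed trajectory the level of `linePrimitive γ₂`, read at the times on the separation
line, does not change along the arcs of `Z₂` and, if the exponents differ, changes in one fixed
direction along the arcs of `Z₁`. -/
lemma exponent_eq_of_closed_trajectory
    (h₁ : Z.IsAdaptedIntegral Z.Z₁ p u U γ₁ κ₁ μ₁ H₁)
    (h₂ : Z.IsAdaptedIntegral Z.Z₂ p u U γ₂ κ₂ μ₂ H₂)
    {T : ℝ} {c : ℝ → ℝ × ℝ} (hT : 0 < T) (hc : Z.IsTrajectory T c) (hclosed : c T = c 0)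
    (hU : ∀ t ∈ Icc 0 T, c t ∈ U) (hp : ∀ t ∈ Icc 0 T, c t ≠ p)
    (h0 : c 0 ∈ Z.sepLine) (hμ : 0 < μ₁ * (u (c 0) - 1)) : γ₁ = γ₂ := by
  have hTl : c T ∈ Z.sepLine := hclosed ▸ h0
  have harc : ∀ s ∈ Icc 0 T, c s ∈ Z.sepLine → s < T → ∃ t ∈ Icc 0 T, c t ∈ Z.sepLine ∧
      ((μ₁ * (u (c s) - 1) < 0 ∧ 0 < μ₁ * (u (c t) - 1) ∧
          linePrimitive γ₁ (u (c s)) = linePrimitive γ₁ (u (c t))) ∨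
        (0 < μ₂ * (u (c s) - 1) ∧ μ₂ * (u (c t) - 1) < 0 ∧
          linePrimitive γ₂ (u (c s)) = linePrimitive γ₂ (u (c t)))) := by
    intro s hs hsl hsT
    obtain ⟨t, ht, hst, htl, hor⟩ := hc.exists_next hTl hs hsT
    have hsub : Icc s t ⊆ Icc 0 T := Icc_subset_Icc hs.1 ht.2
    refine ⟨t, ht, htl, ?_⟩
    rcases hor with hr | hr
    · obtain ⟨a1, a2, a3⟩ := h₁.arc hst (hc.1.mono hsub)
        (fun r hr => ⟨hU r (hsub hr), hp r (hsub hr)⟩) (fun r h => (hr r h).2)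
        (fun r h => (hr r h).1) hsl htl
      exact Or.inl ⟨by linarith, by linarith, a3⟩
    · obtain ⟨a1, a2, a3⟩ := h₂.arc hst (hc.1.mono hsub)
        (fun r hr => ⟨hU r (hsub hr), hp r (hsub hr)⟩) (fun r h => (hr r h).2)
        (fun r h => (hr r h).1) hsl htl
      exact Or.inr ⟨by linarith, by linarith, a3⟩
  have hm0 : (0 : ℝ) ∈ Icc 0 T := ⟨le_rfl, hT.le⟩
  -- The first arc starts where `Z₁` points out of its region, so both fields turn the same way.
  have hμμ : 0 < μ₁ * μ₂ := by
    obtain ⟨t, ht, htl, ⟨a, -, -⟩ | ⟨a, -, -⟩⟩ := harc 0 hm0 h0 hT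
    · linarith
    · have := mul_pos hμ a
      have h3 : 0 ≤ (u (c 0) - 1) ^ 2 := sq_nonneg _
      by_contra! hcon
      nlinarith
  have hsign : ∀ x : ℝ, 0 < μ₁ * x ↔ 0 < μ₂ * x := fun x => by
    rcases pos_and_pos_or_neg_and_neg_of_mul_pos hμμ with ⟨a, b⟩ | ⟨a, b⟩
    · rw [mul_pos_iff_of_pos_left a, mul_pos_iff_of_pos_left b]
    · constructor <;> intro hx
      · exact mul_pos_of_neg_of_neg b (neg_of_mul_pos_right hx a.le)
      · exact mul_pos_of_neg_of_neg a (neg_of_mul_pos_right hx b.le)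
  by_contra hne
  -- The sign of the change of `linePrimitive γ₂` along the arcs of `Z₁`.
  obtain ⟨ε, hε⟩ : ∃ ε : ℝ, ∀ x y : ℝ, 0 < x → 0 < y → μ₁ * (x - 1) < 0 → 0 < μ₁ * (y - 1) →
      linePrimitive γ₁ x = linePrimitive γ₁ y →
      ε * linePrimitive γ₂ y < ε * linePrimitive γ₂ x := by
    have hlt : ∀ x y : ℝ, μ₁ * (x - 1) < 0 → 0 < μ₁ * (y - 1) → 0 < μ₁ * (y - x) :=
      fun x y hx hy => by linarith
    rcases lt_or_gt_of_ne hne with hγ | hγ <;>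
      rcases lt_or_gt_of_ne h₁.μ_ne_zero with hμ₁ | hμ₁ <;>
      have hmono := strictMonoOn_linePrimitive_sub hγ
    · refine ⟨1, fun x y hx hy hx1 hy1 hxy => ?_⟩
      linarith [hmono hy hx (by nlinarith [hlt x y hx1 hy1])]
    · refine ⟨-1, fun x y hx hy hx1 hy1 hxy => ?_⟩
      linarith [hmono hx hy (by nlinarith [hlt x y hx1 hy1])]
    · refine ⟨-1, fun x y hx hy hx1 hy1 hxy => ?_⟩
      linarith [hmono hy hx (by nlinarith [hlt x y hx1 hy1])]
    · refine ⟨1, fun x y hx hy hx1 hy1 hxy => ?_⟩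
      linarith [hmono hx hy (by nlinarith [hlt x y hx1 hy1])]
  obtain ⟨s, ⟨hs, hsl⟩, hmin⟩ := exists_min_image _
    (fun t => ε * linePrimitive γ₂ (u (c t))) hc.2.2.2 ⟨0, hm0, h0⟩
  have hmin' : ∀ t ∈ Icc 0 T, c t ∈ Z.sepLine →
      ε * linePrimitive γ₂ (u (c s)) ≤ ε * linePrimitive γ₂ (u (c t)) := fun t ht htl =>
    hmin t ⟨ht, htl⟩
  -- No arc of `Z₁` starts at a time where the minimum is attained.
  have hno : ∀ t ∈ Icc 0 T, c t ∈ Z.sepLine →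
      linePrimitive γ₂ (u (c t)) = linePrimitive γ₂ (u (c s)) → t < T →
      0 < μ₁ * (u (c t) - 1) ∧ ∃ t' ∈ Icc 0 T, c t' ∈ Z.sepLine ∧ ¬ 0 < μ₁ * (u (c t') - 1) ∧
        linePrimitive γ₂ (u (c t')) = linePrimitive γ₂ (u (c s)) := by
    intro t ht htl heq htT
    obtain ⟨t', ht', htl', ⟨a1, a2, a3⟩ | ⟨a1, a2, a3⟩⟩ := harc t ht htl htT
    · have := hε _ _ (h₁.coord_pos _ (hU t ht)) (h₁.coord_pos _ (hU t' ht')) a1 a2 a3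
      have := hmin' t' ht' htl'
      rw [heq] at *
      linarith
    · exact ⟨(hsign _).2 a1, t', ht', htl', fun h => absurd ((hsign _).1 h) (not_lt.2 a2.le),
        a3.symm.trans heq⟩
  obtain ⟨t, ht, htl, hneg, heq⟩ : ∃ t ∈ Icc 0 T, c t ∈ Z.sepLine ∧
      ¬ 0 < μ₁ * (u (c t) - 1) ∧ linePrimitive γ₂ (u (c t)) = linePrimitive γ₂ (u (c s)) := by
    rcases hs.2.lt_or_eq with hlt | rfl
    · exact (hno s hs hsl rfl hlt).2
    · exact (hno 0 hm0 h0 (by rw [hclosed]) hT).2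
  rcases ht.2.lt_or_eq with hlt | rfl
  · exact hneg (hno t ht htl heq hlt).1
  · exact hneg (hclosed ▸ hμ)

/-- If the exponents agree, a suitable multiple of each first integral gives a function that is
constant along the trajectories of `Z`; since it is injective on every ray from `p`, a trajectory
that has made a full turn is closed. -/
lemma closed_of_exponent_eq {γ : ℝ} (hp : p ∈ Z.sepLine)
    (h₁ : Z.IsAdaptedIntegral Z.Z₁ p u U γ κ₁ μ₁ H₁)
    (h₂ : Z.IsAdaptedIntegral Z.Z₂ p u U γ κ₂ μ₂ H₂)
    {T : ℝ} {c : ℝ → ℝ × ℝ} (hT : 0 < T) (hc : Z.IsTrajectory T c)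
    (hU : ∀ t ∈ Icc 0 T, c t ∈ U) (hturn : TurnsOnceAround p T c) : c T = c 0 := by
  obtain ⟨hcont, hd₁, hd₂, hfin⟩ := hc
  set W : ℝ × ℝ → ℝ := fun q => if Z.h q.1 q.2 ≤ 0 then κ₂ * H₁ q else κ₁ * H₂ q with hW
  have hWc : ContinuousOn (fun t => W (c t)) (Icc 0 T) := by
    have hh : ContinuousOn (fun t => Z.h (c t).1 (c t).2) (Icc 0 T) :=
      continuous_h.comp_continuousOn hcont
    have e₁ : ContinuousOn (fun t => κ₂ * H₁ (c t)) (Icc 0 T) :=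
      (h₁.continuousOn.comp hcont hU).const_smul κ₂
    have e₂ : ContinuousOn (fun t => κ₁ * H₂ (c t)) (Icc 0 T) :=
      (h₂.continuousOn.comp hcont hU).const_smul κ₁
    rw [continuousOn_iff_continuous_domRestrict] at *
    refine Continuous.if_le e₁ e₂ hh continuous_const fun t ht => ?_
    have hl : c t ∈ Z.sepLine := ht
    change κ₂ * H₁ (c t) = κ₁ * H₂ (c t)
    rw [h₁.eq_on_line _ (hU t t.2) hl, h₂.eq_on_line _ (hU t t.2) hl]
    ring
  have hWd : ∀ t ∈ Ioo 0 T \ {t | t ∈ Icc 0 T ∧ c t ∈ Z.sepLine},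
      HasDerivAt (fun t => W (c t)) 0 t := by
    rintro t ⟨ht, hnl⟩
    have htI := Ioo_subset_Icc_self ht
    have hnhds : Icc 0 T ∈ 𝓝 t := Icc_mem_nhds ht.1 ht.2
    have hca : ContinuousAt (fun t => Z.h (c t).1 (c t).2) t :=
      (continuous_h.continuousAt (x := c t)).comp (hcont.continuousAt hnhds)
    have hne : Z.h (c t).1 (c t).2 ≠ 0 := fun h0 => hnl ⟨htI, h0⟩
    rcases lt_or_gt_of_ne hne with hlt | hgt
    · have := (h₁.hasDerivAt_comp (hU t htI)
        ((hd₁ t htI (neg_pos.2 hlt)).hasDerivAt hnhds)).const_mul κ₂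
      rw [mul_zero] at this
      refine this.congr_of_eventuallyEq ?_
      filter_upwards [hca.eventually_lt_const hlt] with s hs
      simp [hW, hs.le]
    · have := (h₂.hasDerivAt_comp (hU t htI)
        ((hd₂ t htI hgt).hasDerivAt hnhds)).const_mul κ₁
      rw [mul_zero] at this
      refine this.congr_of_eventuallyEq ?_
      filter_upwards [hca.eventually_const_lt hgt] with s hs
      simp [hW, hs]
  have hconst : W (c 0) = W (c T) := eq_of_hasDerivAt_zero_off_finite hT.le hfin hWc hWd
  obtain ⟨r, θ, -, hrc, hθ⟩ := hturn
  have hm0 : (0 : ℝ) ∈ Icc 0 T := ⟨le_rfl, hT.le⟩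
  have hmT : T ∈ Icc 0 T := ⟨hT.le, le_rfl⟩
  set v : ℝ × ℝ := (Real.cos (θ 0), Real.sin (θ 0)) with hv
  have hv0 : v ≠ 0 := fun h0 => by
    rw [hv, Prod.mk_eq_zero] at h0
    have := Real.sin_sq_add_cos_sq (θ 0)
    simp [h0.1, h0.2] at this
  have hcs : Real.cos (θ T) = Real.cos (θ 0) ∧ Real.sin (θ T) = Real.sin (θ 0) := by
    rcases (abs_eq (by positivity)).1 hθ with h | h
    · rw [show θ T = θ 0 + 2 * Real.pi by linarith]; simp
    · rw [show θ T = θ 0 - 2 * Real.pi by linarith]; simp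
  have e0 : c 0 = p + r 0 • v := by rw [(hrc 0 hm0).2]; ext <;> simp [hv]
  have eT : c T = p + r T • v := by rw [(hrc T hmT).2, hcs.1, hcs.2]; ext <;> simp [hv]
  have hp' : Z.α * p.1 + Z.β * p.2 + Z.γ = 0 := hp
  have hray : ∀ a b : ℝ, 0 < a → a < b → p + b • v ∈ U → W (p + a • v) ≠ W (p + b • v) := by
    intro a b ha hab hbU
    have hhr : ∀ s : ℝ, Z.h (p + s • v).1 (p + s • v).2 = s * (Z.α * v.1 + Z.β * v.2) := by
      intro s
      simp only [h, Prod.fst_add, Prod.snd_add, Prod.smul_fst, Prod.smul_snd, smul_eq_mul]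
      linear_combination hp'
    obtain ⟨k₁, hk₁⟩ := h₁.ray
    obtain ⟨k₂, hk₂⟩ := h₂.ray
    by_cases hle : Z.α * v.1 + Z.β * v.2 ≤ 0
    · have ea : Z.h (p + a • v).1 (p + a • v).2 ≤ 0 :=
        hhr a ▸ mul_nonpos_of_nonneg_of_nonpos ha.le hle
      have eb : Z.h (p + b • v).1 (p + b • v).2 ≤ 0 :=
        hhr b ▸ mul_nonpos_of_nonneg_of_nonpos (ha.trans hab).le hle
      simp only [hW, ea, eb, if_true]
      intro heq
      have := mul_left_cancel₀ h₂.κ_ne_zero heq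
      exact absurd (hk₁ v a b hv0 ha hab hbU) (by rw [this]; exact lt_irrefl _)
    · have hlt := not_le.1 hle
      have ea : ¬ Z.h (p + a • v).1 (p + a • v).2 ≤ 0 := by
        rw [hhr a]; exact not_le.2 (mul_pos ha hlt)
      have eb : ¬ Z.h (p + b • v).1 (p + b • v).2 ≤ 0 := by
        rw [hhr b]; exact not_le.2 (mul_pos (ha.trans hab) hlt)
      simp only [hW, ea, eb, if_false]
      intro heq
      have := mul_left_cancel₀ h₁.κ_ne_zero heq
      exact absurd (hk₂ v a b hv0 ha hab hbU) (by rw [this]; exact lt_irrefl _)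
  rcases lt_trichotomy (r 0) (r T) with hlt | heq | hgt
  · exact absurd (e0 ▸ eT ▸ hconst) (hray _ _ (hrc 0 hm0).1 hlt (eT ▸ hU T hmT))
  · rw [e0, eT, heq]
  · exact absurd (e0 ▸ eT ▸ hconst.symm) (hray _ _ (hrc T hmT).1 hgt (e0 ▸ hU 0 hm0))

/-- At a monodromic equilibrium with adapted first integrals, center means equal exponents. -/
theorem isCenter_iff_exponent_eq (hp : p ∈ Z.sepLine) (hmono : Z.IsMonodromic p) (hU : U ∈ 𝓝 p)
    (h₁ : Z.IsAdaptedIntegral Z.Z₁ p u U γ₁ κ₁ μ₁ H₁)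
    (h₂ : Z.IsAdaptedIntegral Z.Z₂ p u U γ₂ κ₂ μ₂ H₂)
    (hfreq : ∃ᶠ q in 𝓝[≠] p, q ∈ Z.sepLine ∧ 0 < μ₁ * (u q - 1)) :
    Z.IsCenter p ↔ γ₁ = γ₂ := by
  constructor
  · intro hcen
    obtain ⟨q, ⟨hq, hμ⟩, T, c, hT, hc, hc0, hcT, hcU, hturn⟩ :=
      (hfreq.and_eventually (hcen U hU)).exists
    subst hc0
    exact exponent_eq_of_closed_trajectory h₁ h₂ hT hc hcT hcU (fun t ht => hturn.ne ht) hq hμ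
  · rintro rfl V hV
    filter_upwards [hmono (V ∩ U) (inter_mem hV hU)] with q hq
    obtain ⟨T, c, hT, hc, hc0, hcV, hturn⟩ := hq
    exact ⟨T, c, hT, hc, hc0,
      hc0 ▸ closed_of_exponent_eq hp h₁ h₂ hT hc (fun t ht => (hcV t ht).2) hturn,
      fun t ht => (hcV t ht).1, hturn⟩

end Center

end PiecewiseKolmogorov

/-! ### Equilibria with purely imaginary eigenvalues -/

/-- The expression in parentheses is the radial derivative of the first integral, up to a positive
factor, at displacement `(ξ, η)` from the equilibrium. Its quadratic part is definite with the sign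
of `C` and dominates the cubic part near the origin. -/
lemma exists_definite_near_zero {B C E : ℝ} (hΔ : 0 < -B ^ 2 - C * E) :
    ∃ δ > 0, ∀ ξ η : ℝ, |ξ| < δ → |η| < δ → (ξ ≠ 0 ∨ η ≠ 0) →
      0 < C * ((1 + ξ) * (B * ξ + C * η) * η - (1 + η) * (E * ξ - B * η) * ξ) := by
  have hCE : 0 < -(C * E) := by nlinarith [sq_nonneg B]
  have hC : C ≠ 0 := by rintro rfl; simp at hCE
  set m : ℝ := C ^ 2 * (-B ^ 2 - C * E) with hm
  have hm0 : 0 < m := by positivity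
  set K : ℝ := |C| * (|B - E| + |B + C|) with hK
  have hK0 : 0 ≤ K := by positivity
  set τ : ℝ := C ^ 2 - C * E with hτ
  have hτ0 : 0 < τ := by nlinarith [sq_nonneg C]
  -- A positive definite binary form is bounded below by its determinant over its trace.
  have hquad : ∀ ξ η : ℝ, m * (ξ ^ 2 + η ^ 2) ≤
      τ * (C * (C * η ^ 2 + 2 * B * ξ * η - E * ξ ^ 2)) := fun ξ η => by
    have : τ * (C * (C * η ^ 2 + 2 * B * ξ * η - E * ξ ^ 2)) - m * (ξ ^ 2 + η ^ 2)
        = (C ^ 2 * η + B * C * ξ) ^ 2 + (C * E * ξ - B * C * η) ^ 2 := by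
      rw [hm, hτ]; ring
    linarith [sq_nonneg (C ^ 2 * η + B * C * ξ), sq_nonneg (C * E * ξ - B * C * η)]
  refine ⟨m / (τ * K + 1), by positivity, fun ξ η hξ hη h0 => ?_⟩
  set δ := m / (τ * K + 1) with hδ
  have hδ0 : 0 < δ := by positivity
  have hδm : τ * K * δ < m := by
    have : δ * (τ * K + 1) = m := div_mul_cancel₀ _ (by positivity)
    linarith
  have hS : 0 < ξ ^ 2 + η ^ 2 := by rcases h0 with h | h <;> positivity
  have hcub : |C * (ξ * η * ((B - E) * ξ + (B + C) * η))| ≤ K * δ * (ξ ^ 2 + η ^ 2) := by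
    have h1 : |ξ * η| ≤ ξ ^ 2 + η ^ 2 := by
      rw [abs_mul]
      nlinarith [sq_nonneg (|ξ| - |η|), sq_abs ξ, sq_abs η, sq_nonneg ξ, sq_nonneg η]
    have h2 : |(B - E) * ξ + (B + C) * η| ≤ (|B - E| + |B + C|) * δ :=
      calc |(B - E) * ξ + (B + C) * η| ≤ |B - E| * |ξ| + |B + C| * |η| := by
            simpa only [abs_mul] using abs_add_le ((B - E) * ξ) ((B + C) * η)
        _ ≤ |B - E| * δ + |B + C| * δ := by gcongr
        _ = _ := by ring
    calc _ = |C| * (|ξ * η| * |(B - E) * ξ + (B + C) * η|) := by rw [abs_mul, abs_mul (ξ * η)]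
      _ ≤ |C| * ((ξ ^ 2 + η ^ 2) * ((|B - E| + |B + C|) * δ)) := by gcongr
      _ = _ := by rw [hK]; ring
  have h3 := mul_le_mul_of_nonneg_left (neg_le_of_abs_le hcub) hτ0.le
  have h4 := mul_lt_mul_of_pos_right hδm hS
  refine pos_of_mul_pos_right (a := τ) ?_ hτ0.le
  calc 0 < m * (ξ ^ 2 + η ^ 2) + τ * -(K * δ * (ξ ^ 2 + η ^ 2)) := by linarith
    _ ≤ _ := add_le_add (hquad ξ η) h3
    _ = _ := by ring

namespace KolmogorovSystem

lemma jac_eq (S : KolmogorovSystem) (q : ℝ × ℝ) :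
    S.jac q = !![S.a + 2 * S.b * q.1 + S.c * q.2, S.c * q.1;
      S.e * q.2, S.d + S.e * q.1 + 2 * S.f * q.2] := by
  have h1 : deriv (fun x => (S.field (x, q.2)).1) q.1 = S.a + 2 * S.b * q.1 + S.c * q.2 := by
    refine HasDerivAt.deriv ?_
    refine ((hasDerivAt_id q.1).mul ((((hasDerivAt_id q.1).const_mul S.b).const_add
      S.a).add_const (S.c * q.2))).congr_deriv ?_
    simp; ring
  have h2 : deriv (fun y => (S.field (q.1, y)).1) q.2 = S.c * q.1 := by
    refine HasDerivAt.deriv ?_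
    refine ((((hasDerivAt_id q.2).const_mul S.c).const_add
      (S.a + S.b * q.1)).const_mul q.1).congr_deriv ?_
    ring
  have h3 : deriv (fun x => (S.field (x, q.2)).2) q.1 = S.e * q.2 := by
    refine HasDerivAt.deriv ?_
    refine (((((hasDerivAt_id q.1).const_mul S.e).const_add S.d).add_const
      (S.f * q.2)).const_mul q.2).congr_deriv ?_
    ring
  have h4 : deriv (fun y => (S.field (q.1, y)).2) q.2 = S.d + S.e * q.1 + 2 * S.f * q.2 := by
    refine HasDerivAt.deriv ?_
    refine ((hasDerivAt_id q.2).mul (((hasDerivAt_id q.2).const_mul S.f).const_add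
      (S.d + S.e * q.1))).congr_deriv ?_
    simp; ring
  rw [jac, h1, h2, h3, h4]

lemma IsLinearCenter.trace_eq_zero_and_det_pos {S : KolmogorovSystem} {p : ℝ × ℝ}
    (h : S.IsLinearCenter p) : (S.jac p).trace = 0 ∧ 0 < (S.jac p).det := by
  obtain ⟨l, hl⟩ := spectrum.nonempty_of_isAlgClosed_of_finiteDimensional ℂ
    ((S.jac p).map (algebraMap ℝ ℂ))
  obtain ⟨hre, him⟩ := h.2 l hl
  rw [Matrix.mem_spectrum_iff_isRoot_charpoly, Matrix.charpoly_fin_two] at hl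
  have ht : ((S.jac p).map (algebraMap ℝ ℂ)).trace = ((S.jac p).trace : ℂ) := by
    simp [Matrix.trace_fin_two]
  have hd : ((S.jac p).map (algebraMap ℝ ℂ)).det = ((S.jac p).det : ℂ) := by
    simp [Matrix.det_fin_two]
  rw [ht, hd] at hl
  simp only [Polynomial.IsRoot.def, Polynomial.eval_add, Polynomial.eval_sub, Polynomial.eval_pow,
    Polynomial.eval_X, Polynomial.eval_mul, Polynomial.eval_C] at hl
  have h1 := congrArg Complex.re hl
  have h2 := congrArg Complex.im hl
  simp [pow_two, hre] at h1 h2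
  have h3 : 0 < l.im * l.im := mul_self_pos.2 him
  exact ⟨h2.resolve_right him, by linarith⟩

/-- The system `S` has an equilibrium with nonzero coordinates at `p` whose Jacobian matrix has
zero trace and positive determinant. -/
structure IsCenterType (S : KolmogorovSystem) (p : ℝ × ℝ) : Prop where
  fst_ne_zero : p.1 ≠ 0
  snd_ne_zero : p.2 ≠ 0
  fst_eq : S.a + S.b * p.1 + S.c * p.2 = 0
  snd_eq : S.d + S.e * p.1 + S.f * p.2 = 0
  trace_eq : S.b * p.1 + S.f * p.2 = 0
  det_pos : 0 < p.1 * p.2 * (S.b * S.f - S.c * S.e)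

lemma IsLinearCenter.isCenterType {S : KolmogorovSystem} {p : ℝ × ℝ}
    (h : S.IsLinearCenter p) : S.IsCenterType p := by
  obtain ⟨ht, hd⟩ := h.trace_eq_zero_and_det_pos
  have hf := h.1
  simp only [field, Prod.mk_eq_zero] at hf
  rw [jac_eq, Matrix.trace_fin_two_of] at ht
  rw [jac_eq, Matrix.det_fin_two_of] at hd
  have h1 : p.1 ≠ 0 := fun h0 => by
    simp only [h0] at ht hd
    have e : S.d + S.e * 0 + 2 * S.f * p.2 = -(S.a + 2 * S.b * 0 + S.c * p.2) := by linarith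
    rw [e] at hd
    nlinarith [sq_nonneg (S.a + 2 * S.b * 0 + S.c * p.2)]
  have h2 : p.2 ≠ 0 := fun h0 => by
    simp only [h0] at ht hd
    have e : S.d + S.e * p.1 + 2 * S.f * 0 = -(S.a + 2 * S.b * p.1 + S.c * 0) := by linarith
    rw [e] at hd
    nlinarith [sq_nonneg (S.a + 2 * S.b * p.1 + S.c * 0)]
  have e1 := (mul_eq_zero.1 hf.1).resolve_left h1
  have e2 := (mul_eq_zero.1 hf.2).resolve_left h2
  refine ⟨h1, h2, e1, e2, by linarith, ?_⟩
  have e3 : S.a + 2 * S.b * p.1 + S.c * p.2 = S.b * p.1 := by linarith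
  have e4 : S.d + S.e * p.1 + 2 * S.f * p.2 = S.f * p.2 := by linarith
  rw [e3, e4] at hd
  linarith

lemma IsCenterType.det_jac {S : KolmogorovSystem} {p : ℝ × ℝ} (h : S.IsCenterType p) :
    (S.jac p).det = p.1 * p.2 * (S.b * S.f - S.c * S.e) := by
  have e3 : S.a + 2 * S.b * p.1 + S.c * p.2 = S.b * p.1 := by linarith [h.fst_eq]
  have e4 : S.d + S.e * p.1 + 2 * S.f * p.2 = S.f * p.2 := by linarith [h.snd_eq]
  rw [jac_eq, Matrix.det_fin_two_of, e3, e4]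
  ring

/-! ### The integrating factor and its first integral -/

/-- The exponent `A` for which `x ^ (A - 1) * y ^ (B - 1)` is an integrating factor. -/
noncomputable def expX (S : KolmogorovSystem) : ℝ := S.f * (S.e - S.b) / (S.b * S.f - S.c * S.e)

/-- The exponent `B` for which `x ^ (A - 1) * y ^ (B - 1)` is an integrating factor. -/
noncomputable def expY (S : KolmogorovSystem) : ℝ := S.b * (S.c - S.f) / (S.b * S.f - S.c * S.e)

/-- The first integral, in the variables `X = x / p.1`, `Y = y / p.2`, obtained by integrating the
closed form `X ^ (A - 1) * Y ^ (B - 1) * (X * P dY - Y * Q dX)`, where `P`, `Q` are the linear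
factors of the field. The use of `powPrimitive` covers the exponents where logarithms appear. -/
noncomputable def firstIntegral (S : KolmogorovSystem) (p q : ℝ × ℝ) : ℝ :=
  (q.1 / p.1) ^ S.expX * ((S.a + S.b * p.1 * (q.1 / p.1)) * powPrimitive S.expY (q.2 / p.2)
      + S.c * p.2 * powPrimitive (S.expY + 1) (q.2 / p.2))
    - ((S.d + S.f * p.2) * powPrimitive S.expX (q.1 / p.1)
      + S.e * p.1 * powPrimitive (S.expX + 1) (q.1 / p.1))

namespace IsCenterType

variable {S : KolmogorovSystem} {p : ℝ × ℝ}

lemma det_ne_zero (h : S.IsCenterType p) : S.b * S.f - S.c * S.e ≠ 0 := fun h0 => by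
  simpa [h0] using h.det_pos

lemma expX_mul_det (h : S.IsCenterType p) :
    S.expX * (S.b * S.f - S.c * S.e) = S.f * (S.e - S.b) :=
  div_mul_cancel₀ _ h.det_ne_zero

lemma expY_mul_det (h : S.IsCenterType p) :
    S.expY * (S.b * S.f - S.c * S.e) = S.b * (S.c - S.f) :=
  div_mul_cancel₀ _ h.det_ne_zero

lemma exponents_fst (h : S.IsCenterType p) : S.expX * S.b + S.expY * S.e = -S.b :=
  mul_right_cancel₀ h.det_ne_zero (by
    linear_combination S.b * h.expX_mul_det + S.e * h.expY_mul_det)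

lemma exponents_snd (h : S.IsCenterType p) : S.expX * S.c + S.expY * S.f = -S.f :=
  mul_right_cancel₀ h.det_ne_zero (by
    linear_combination S.c * h.expX_mul_det + S.f * h.expY_mul_det)

lemma exponents_const (h : S.IsCenterType p) : S.expX * S.a + S.expY * S.d = 0 := by
  linear_combination S.expX * h.fst_eq + S.expY * h.snd_eq - p.1 * h.exponents_fst
    - p.2 * h.exponents_snd + h.trace_eq

/-- Up to a positive factor, the determinant of the second derivative of the first integral at the
equilibrium, in the variables `x / p.1`, `y / p.2`. -/
lemma discr_pos (h : S.IsCenterType p) :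
    0 < -(S.b * p.1) ^ 2 - (S.c * p.2) * (S.e * p.1) := by
  have : -(S.b * p.1) ^ 2 - (S.c * p.2) * (S.e * p.1) = p.1 * p.2 * (S.b * S.f - S.c * S.e) := by
    linear_combination -S.b * p.1 * h.trace_eq
  rw [this]
  exact h.det_pos

lemma c_mul_e_ne_zero (h : S.IsCenterType p) : S.c * p.2 * (S.e * p.1) ≠ 0 := by
  nlinarith [h.discr_pos, sq_nonneg (S.b * p.1)]

/-- The field is transverse to the line through the origin, near the equilibrium. -/
lemma diag_ne_zero (h : S.IsCenterType p) :
    S.b * p.1 + S.c * p.2 - S.e * p.1 - S.f * p.2 ≠ 0 := fun h0 => by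
  have : S.c * p.2 = S.e * p.1 - 2 * (S.b * p.1) := by linear_combination h0 + h.trace_eq
  have h1 := h.discr_pos
  rw [this] at h1
  nlinarith [sq_nonneg (S.b * p.1 - S.e * p.1)]

/-- The differential of the first integral is the field, rotated by a right angle and multiplied
by the integrating factor. -/
lemma hasFDerivAt_firstIntegral (h : S.IsCenterType p) {q : ℝ × ℝ} (hX : 0 < q.1 / p.1)
    (hY : 0 < q.2 / p.2) :
    HasFDerivAt (S.firstIntegral p)
      (((q.1 / p.1) ^ (S.expX - 1) * (q.2 / p.2) ^ (S.expY - 1)) •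
        ((q.1 / p.1 * (S.a + S.b * q.1 + S.c * q.2) / p.2) • ContinuousLinearMap.snd ℝ ℝ ℝ
          - (q.2 / p.2 * (S.d + S.e * q.1 + S.f * q.2) / p.1) • ContinuousLinearMap.fst ℝ ℝ ℝ)) q
      := by
  have hp1 := h.fst_ne_zero
  have hp2 := h.snd_ne_zero
  have d₁ : HasFDerivAt (fun q : ℝ × ℝ => q.1 / p.1) (p.1⁻¹ • ContinuousLinearMap.fst ℝ ℝ ℝ) q := by
    simpa only [div_eq_inv_mul] using (hasFDerivAt_fst (𝕜 := ℝ) (p := q)).const_mul p.1⁻¹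
  have d₂ : HasFDerivAt (fun q : ℝ × ℝ => q.2 / p.2) (p.2⁻¹ • ContinuousLinearMap.snd ℝ ℝ ℝ) q := by
    simpa only [div_eq_inv_mul] using (hasFDerivAt_snd (𝕜 := ℝ) (p := q)).const_mul p.2⁻¹
  have p₁ := (Real.hasDerivAt_rpow_const (p := S.expX) (Or.inl hX.ne')).comp_hasFDerivAt q d₁
  have i₁ := (hasDerivAt_powPrimitive S.expX hX).comp_hasFDerivAt q d₁
  have i₂ := (hasDerivAt_powPrimitive (S.expX + 1) hX).comp_hasFDerivAt q d₁
  have j₁ := (hasDerivAt_powPrimitive S.expY hY).comp_hasFDerivAt q d₂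
  have j₂ := (hasDerivAt_powPrimitive (S.expY + 1) hY).comp_hasFDerivAt q d₂
  have key := (p₁.mul ((((d₁.const_mul (S.b * p.1)).const_add S.a).mul j₁).add
    (j₂.const_mul (S.c * p.2)))).sub
    ((i₁.const_mul (S.d + S.f * p.2)).add (i₂.const_mul (S.e * p.1)))
  refine key.congr_fderiv (ContinuousLinearMap.ext fun v => ?_)
  have e1 : S.b * q.1 = S.b * p.1 * (q.1 / p.1) := by field_simp
  have e2 : S.c * q.2 = S.c * p.2 * (q.2 / p.2) := by field_simp
  have e3 : S.e * q.1 = S.e * p.1 * (q.1 / p.1) := by field_simp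
  have e4 : S.f * q.2 = S.f * p.2 * (q.2 / p.2) := by field_simp
  rw [e1, e2, e3, e4]
  have k1 := rpow_eq_one_add_mul_powPrimitive S.expY (q.2 / p.2)
  have k2 := rpow_eq_one_add_mul_powPrimitive (S.expY + 1) (q.2 / p.2)
  have w1 := Real.rpow_sub_one hX.ne' S.expX
  have w2 := Real.rpow_sub_one hY.ne' S.expY
  have w3 := Real.rpow_add_one hY.ne' S.expY
  simp only [Function.comp, add_sub_cancel_right, Pi.add_apply, Pi.mul_apply, add_apply, sub_apply,
    smul_apply, smul_eq_mul,
    ContinuousLinearMap.coe_fst', ContinuousLinearMap.coe_snd']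
  set X := q.1 / p.1
  set Y := q.2 / p.2
  rw [eq_div_iff hX.ne'] at w1
  rw [eq_div_iff hY.ne'] at w2
  rw [← w1]
  generalize X ^ (S.expX - 1) = w at *
  generalize powPrimitive S.expY Y = I at *
  generalize powPrimitive (S.expY + 1) Y = J at *
  rw [← w2] at k1 w3 ⊢
  rw [w3] at k2
  generalize Y ^ (S.expY - 1) = z at *
  have m1 := h.exponents_fst
  have m2 := h.exponents_snd
  have m3 := h.exponents_const
  simp only [div_eq_mul_inv]
  linear_combination (w * p.1⁻¹ * v.1) * (I * m3 + p.1 * X * I * m1 + p.2 * J * m2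
    + (S.d + S.e * p.1 * X) * k1 + S.f * p.2 * k2)

end IsCenterType
end KolmogorovSystem

/-! ### The first integral near the equilibrium and on the three lines -/

namespace KolmogorovSystem

/-- The open box of half-width `δ` around `p`, in the variables `x / p.1`, `y / p.2`. -/
def relBox (p : ℝ × ℝ) (δ : ℝ) : Set (ℝ × ℝ) :=
  {q | |q.1 / p.1 - 1| < δ ∧ |q.2 / p.2 - 1| < δ}

lemma relBox_mem_nhds {p : ℝ × ℝ} (h₁ : p.1 ≠ 0) (h₂ : p.2 ≠ 0) {δ : ℝ} (hδ : 0 < δ) :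
    relBox p δ ∈ 𝓝 p := by
  have ho₁ : IsOpen {q : ℝ × ℝ | |q.1 / p.1 - 1| < δ} := isOpen_lt (by fun_prop) continuous_const
  have ho₂ : IsOpen {q : ℝ × ℝ | |q.2 / p.2 - 1| < δ} := isOpen_lt (by fun_prop) continuous_const
  have ho : IsOpen (relBox p δ) := ho₁.inter ho₂
  exact ho.mem_nhds (by simp [relBox, h₁, h₂, hδ])

lemma pos_of_mem_relBox {p q : ℝ × ℝ} {δ : ℝ} (hδ : δ ≤ 1) (hq : q ∈ relBox p δ) :
    0 < q.1 / p.1 ∧ 0 < q.2 / p.2 :=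
  ⟨by linarith [(abs_lt.1 hq.1).1], by linarith [(abs_lt.1 hq.2).1]⟩

namespace IsCenterType

variable {S : KolmogorovSystem} {p : ℝ × ℝ}

lemma exists_firstIntegral_hasFDerivAt (h : S.IsCenterType p) {q : ℝ × ℝ} (hX : 0 < q.1 / p.1)
    (hY : 0 < q.2 / p.2) :
    ∃ L : ℝ × ℝ →L[ℝ] ℝ, HasFDerivAt (S.firstIntegral p) L q ∧ L (S.field q) = 0 := by
  refine ⟨_, h.hasFDerivAt_firstIntegral hX hY, ?_⟩
  simp only [field, sub_apply, smul_apply, smul_eq_mul, ContinuousLinearMap.coe_fst',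
    ContinuousLinearMap.coe_snd']
  ring

/-- Near the equilibrium the first integral is strictly monotone along rays, since it has a
definite second derivative there. -/
lemma exists_strictMono_on_rays (h : S.IsCenterType p) :
    ∃ δ > 0, δ ≤ 1 ∧ ∀ v : ℝ × ℝ, ∀ r₁ r₂ : ℝ, v ≠ 0 → 0 < r₁ → r₁ < r₂ →
      p + r₂ • v ∈ relBox p δ → S.c * p.2 * S.firstIntegral p (p + r₁ • v) <
        S.c * p.2 * S.firstIntegral p (p + r₂ • v) := by
  have hp1 := h.fst_ne_zero
  have hp2 := h.snd_ne_zero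
  obtain ⟨δ, hδ, hdef⟩ := exists_definite_near_zero h.discr_pos
  refine ⟨min δ 1, lt_min hδ one_pos, min_le_right _ _, fun v r₁ r₂ hv hr₁ hr hbox => ?_⟩
  have hm : ∀ r ∈ Icc r₁ r₂, p + r • v ∈ relBox p (min δ 1) := fun r hr' => by
    have hr0 : 0 < r := hr₁.trans_le hr'.1
    have e1 : ∀ r : ℝ, (p + r • v).1 / p.1 - 1 = r * (v.1 / p.1) := fun r => by
      simp only [Prod.fst_add, Prod.smul_fst, smul_eq_mul]; field_simp; ring
    have e2 : ∀ r : ℝ, (p + r • v).2 / p.2 - 1 = r * (v.2 / p.2) := fun r => by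
      simp only [Prod.snd_add, Prod.smul_snd, smul_eq_mul]; field_simp; ring
    simp only [relBox, mem_ofPred_eq, e1, e2, abs_mul, abs_of_pos hr0,
      abs_of_pos (hr₁.trans hr)] at hbox ⊢
    exact ⟨(mul_le_mul_of_nonneg_right hr'.2 (abs_nonneg _)).trans_lt hbox.1,
      (mul_le_mul_of_nonneg_right hr'.2 (abs_nonneg _)).trans_lt hbox.2⟩
  have hd : ∀ r ∈ Icc r₁ r₂, ∃ D > 0,
      HasDerivAt (fun r : ℝ => S.c * p.2 * S.firstIntegral p (p + r • v)) D r := fun r hr' => by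
    obtain ⟨hX, hY⟩ := pos_of_mem_relBox (min_le_right _ _) (hm r hr')
    have hr0 : 0 < r := hr₁.trans_le hr'.1
    have hl : HasDerivAt (fun r : ℝ => p + r • v) v r := by
      simpa using ((hasDerivAt_id r).smul_const v).const_add p
    refine ⟨_, ?_, ((h.hasFDerivAt_firstIntegral hX hY).comp_hasDerivAt r hl).const_mul _⟩
    have hne : v.1 / p.1 ≠ 0 ∨ v.2 / p.2 ≠ 0 := by
      by_contra! h0
      exact hv (Prod.ext (by simpa [hp1] using h0.1) (by simpa [hp2] using h0.2))
    have eX : (p + r • v).1 = p.1 * (1 + r * (v.1 / p.1)) := by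
      simp only [Prod.fst_add, Prod.smul_fst, smul_eq_mul]; field_simp
    have eY : (p + r • v).2 = p.2 * (1 + r * (v.2 / p.2)) := by
      simp only [Prod.snd_add, Prod.smul_snd, smul_eq_mul]; field_simp
    have hmem := hm r hr'
    have eX' : (p + r • v).1 / p.1 = 1 + r * (v.1 / p.1) := by rw [eX]; field_simp
    have eY' : (p + r • v).2 / p.2 = 1 + r * (v.2 / p.2) := by rw [eY]; field_simp
    simp only [relBox, mem_ofPred_eq, eX', eY', add_sub_cancel_left] at hmem
    have hG := hdef (r * (v.1 / p.1)) (r * (v.2 / p.2)) (hmem.1.trans_le (min_le_left _ _))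
      (hmem.2.trans_le (min_le_left _ _)) (hne.imp (mul_ne_zero hr0.ne') (mul_ne_zero hr0.ne'))
    have hw : 0 < ((p + r • v).1 / p.1) ^ (S.expX - 1) * ((p + r • v).2 / p.2) ^ (S.expY - 1) := by
      positivity
    simp only [smul_apply, sub_apply, smul_eq_mul, ContinuousLinearMap.coe_fst',
      ContinuousLinearMap.coe_snd']
    set w := ((p + r • v).1 / p.1) ^ (S.expX - 1) * ((p + r • v).2 / p.2) ^ (S.expY - 1)
    rw [eX', eY', eX, eY]
    refine pos_of_mul_pos_right (a := r) ((mul_pos hw hG).trans_eq ?_) hr0.le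
    simp only [div_eq_mul_inv]
    linear_combination (w * (S.c * p.2)) * (
      -(1 + r * (v.1 * p.1⁻¹)) * (r * (v.2 * p.2⁻¹)) * h.fst_eq
      + (1 + r * (v.2 * p.2⁻¹)) * (r * (v.1 * p.1⁻¹)) * h.snd_eq
      + (1 + r * (v.2 * p.2⁻¹)) * (r * (v.1 * p.1⁻¹)) * (r * (v.2 * p.2⁻¹)) * h.trace_eq)
  have hmono : StrictMonoOn (fun r : ℝ => S.c * p.2 * S.firstIntegral p (p + r • v))
      (Icc r₁ r₂) := by
    refine strictMonoOn_of_deriv_pos (convex_Icc _ _) (fun r hr' => ?_) fun r hr' => ?_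
    · obtain ⟨D, -, hD⟩ := hd r hr'
      exact hD.continuousAt.continuousWithinAt
    · obtain ⟨D, hD0, hD⟩ := hd r (interior_subset hr')
      rwa [hD.deriv]
  exact hmono (left_mem_Icc.2 hr.le) (right_mem_Icc.2 hr.le) hr

lemma firstIntegral_horizontal (h : S.IsCenterType p) (x : ℝ) :
    S.firstIntegral p (x, p.2) = -(S.e * p.1) * linePrimitive S.expX (x / p.1) := by
  simp only [firstIntegral, div_self h.snd_ne_zero, powPrimitive_one, linePrimitive]
  linear_combination -powPrimitive S.expX (x / p.1) * h.snd_eq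

lemma firstIntegral_vertical (h : S.IsCenterType p) (y : ℝ) :
    S.firstIntegral p (p.1, y) = S.c * p.2 * linePrimitive S.expY (y / p.2) := by
  simp only [firstIntegral, div_self h.fst_ne_zero, powPrimitive_one, linePrimitive,
    Real.one_rpow]
  linear_combination powPrimitive S.expY (y / p.2) * h.fst_eq

lemma firstIntegral_diag (h : S.IsCenterType p) {s : ℝ} (hs : 0 < s) :
    S.firstIntegral p (p.1 * s, p.2 * s) =
      (S.b * p.1 + S.c * p.2 - S.e * p.1 - S.f * p.2) *
        linePrimitive (S.expX + S.expY) s := by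
  have hp1 := h.fst_ne_zero
  have hp2 := h.snd_ne_zero
  have hd₁ : ∀ t : ℝ, 0 < t → HasDerivAt (fun t => S.firstIntegral p (p.1 * t, p.2 * t))
      ((S.b * p.1 + S.c * p.2 - S.e * p.1 - S.f * p.2) *
        (t ^ (S.expX + S.expY - 1) * (t - 1))) t := fun t ht => by
    have e1 : p.1 * t / p.1 = t := mul_div_cancel_left₀ t hp1
    have e2 : p.2 * t / p.2 = t := mul_div_cancel_left₀ t hp2
    have hl : HasDerivAt (fun t : ℝ => (p.1 * t, p.2 * t)) p t := by
      simpa using ((hasDerivAt_id t).const_mul p.1).prodMk ((hasDerivAt_id t).const_mul p.2)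
    refine ((h.hasFDerivAt_firstIntegral (q := (p.1 * t, p.2 * t)) (by simpa only [e1])
      (by simpa only [e2])).comp_hasDerivAt t hl).congr_deriv ?_
    have hpow : t ^ (S.expX + S.expY - 1) = t ^ (S.expX - 1) * t ^ (S.expY - 1) * t := by
      rw [← Real.rpow_add ht, ← Real.rpow_add_one ht.ne']
      ring_nf
    simp only [e1, e2, smul_apply, sub_apply, smul_eq_mul, ContinuousLinearMap.coe_fst',
      ContinuousLinearMap.coe_snd', div_mul_cancel₀ _ hp1, div_mul_cancel₀ _ hp2, hpow]
    linear_combination t ^ (S.expX - 1) * t ^ (S.expY - 1) * t * (h.fst_eq - h.snd_eq)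
  have hd₂ : ∀ t : ℝ, 0 < t → HasDerivAt (fun t =>
      (S.b * p.1 + S.c * p.2 - S.e * p.1 - S.f * p.2) * linePrimitive (S.expX + S.expY) t)
      ((S.b * p.1 + S.c * p.2 - S.e * p.1 - S.f * p.2) *
        (t ^ (S.expX + S.expY - 1) * (t - 1))) t := fun t ht =>
    (hasDerivAt_linePrimitive _ ht).const_mul _
  refine isOpen_Ioi.eqOn_of_deriv_eq isPreconnected_Ioi
    (fun t ht => (hd₁ t ht).differentiableAt.differentiableWithinAt)
    (fun t ht => (hd₂ t ht).differentiableAt.differentiableWithinAt)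
    (fun t ht => (hd₁ t ht).deriv.trans (hd₂ t ht).deriv.symm) (mem_Ioi.2 one_pos) ?_ hs
  simp [firstIntegral, linePrimitive_one, powPrimitive_one, hp1, hp2]

/-- The exponent that governs the line `y = p.2`, cleared of denominators. -/
lemma expX_formula (h : S.IsCenterType p) :
    (S.jac p).det * S.expX = p.1 ^ 2 * (S.b * (S.b - S.e)) := by
  rw [h.det_jac]
  linear_combination p.1 * p.2 * h.expX_mul_det + p.1 * (S.e - S.b) * h.trace_eq

/-- The exponent that governs the line `x = p.1`, cleared of denominators. -/
lemma expY_formula (h : S.IsCenterType p) :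
    (S.jac p).det * (S.e * S.expY) =
      -(S.b * ((S.jac p).det + p.1 ^ 2 * (S.b * (S.b - S.e)))) := by
  rw [h.det_jac]
  linear_combination p.1 * p.2 * S.e * h.expY_mul_det + S.b * p.1 * (S.b - S.e) * h.trace_eq

lemma e_ne_zero (h : S.IsCenterType p) : S.e ≠ 0 := fun h0 =>
  h.c_mul_e_ne_zero (by simp [h0])

/-- The exponent that governs the line through the origin, cleared of denominators. -/
lemma expX_add_expY_formula (h : S.IsCenterType p) :
    (S.jac p).det * (S.e * (S.expX + S.expY)) =
      -(S.b * ((S.jac p).det + p.1 ^ 2 * (S.b - S.e) ^ 2)) := by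
  linear_combination S.e * h.expX_formula + h.expY_formula

end IsCenterType
end KolmogorovSystem

/-! ### The three separation lines -/

namespace PiecewiseKolmogorov

variable {Z : PiecewiseKolmogorov} {S : KolmogorovSystem} {p : ℝ × ℝ}

lemma frequently_of_ray {P : ℝ × ℝ → Prop} {v : ℝ × ℝ} (hv : v ≠ 0)
    (h : ∀ s : ℝ, 0 < s → P (p + s • v)) : ∃ᶠ q in 𝓝[≠] p, P q := by
  have ht : Tendsto (fun s : ℝ => p + s • v) (𝓝[>] 0) (𝓝[≠] p) := by
    refine tendsto_nhdsWithin_iff.2 ⟨?_, ?_⟩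
    · have : Continuous fun s : ℝ => p + s • v := by fun_prop
      simpa using (this.tendsto 0).mono_left nhdsWithin_le_nhds
    · filter_upwards [self_mem_nhdsWithin] with s hs
      simpa using ⟨(ne_of_gt hs), hv⟩
  refine ht.frequently (Eventually.frequently ?_)
  filter_upwards [self_mem_nhdsWithin] with s hs using h s hs

open KolmogorovSystem

/-- The dynamical part of an adapted integral holds for every line; only the behaviour on the
line depends on its position. -/
lemma exists_isAdaptedIntegral (h : S.IsCenterType p) {u : ℝ × ℝ → ℝ} {γ κ μ : ℝ}
    (hu : ∀ q : ℝ × ℝ, 0 < q.1 / p.1 → 0 < q.2 / p.2 → 0 < u q)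
    (hne : ∀ q ∈ Z.sepLine, u q = 1 → q = p)
    (hline : ∀ q ∈ Z.sepLine, 0 < u q → S.firstIntegral p q = κ * linePrimitive γ (u q) ∧
      ∃ w : ℝ, 0 < w ∧ Z.α * (S.field q).1 + Z.β * (S.field q).2 = μ * w * (u q - 1))
    (hκ : κ ≠ 0) (hμ : μ ≠ 0) :
    ∃ U ∈ 𝓝 p, Z.IsAdaptedIntegral S p u U γ κ μ (S.firstIntegral p) := by
  obtain ⟨δ, hδ, hδ1, hray⟩ := h.exists_strictMono_on_rays
  have hpos : ∀ q ∈ relBox p δ, 0 < u q := fun q hq =>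
    hu q (pos_of_mem_relBox hδ1 hq).1 (pos_of_mem_relBox hδ1 hq).2
  exact ⟨relBox p δ, relBox_mem_nhds h.fst_ne_zero h.snd_ne_zero hδ,
    { hasFDerivAt := fun q hq => h.exists_firstIntegral_hasFDerivAt
        (pos_of_mem_relBox hδ1 hq).1 (pos_of_mem_relBox hδ1 hq).2
      ray := ⟨_, hray⟩
      coord_pos := hpos
      coord_ne_one := fun q _ hl hqp h1 => hqp (hne q hl h1)
      eq_on_line := fun q hq hl => (hline q hl (hpos q hq)).1
      normal_velocity := fun q hq hl => (hline q hl (hpos q hq)).2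
      κ_ne_zero := hκ
      μ_ne_zero := hμ }⟩

/-- On the horizontal line through `p` the exponent is `expX`. -/
lemma exists_isAdaptedIntegral_horizontal (h : S.IsCenterType p)
    (hZ : ∀ x y, Z.h x y = y - p.2) :
    ∃ U ∈ 𝓝 p, Z.IsAdaptedIntegral S p (fun q => q.1 / p.1) U S.expX (-(S.e * p.1))
      (p.2 * (S.e * p.1)) (S.firstIntegral p) := by
  have hp1 := h.fst_ne_zero
  have hl : ∀ q ∈ Z.sepLine, q.2 = p.2 := fun q hq => sub_eq_zero.1 ((hZ _ _).symm.trans hq)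
  have hα : Z.α = 0 := by
    have h0 := hZ 0 0; have h1 := hZ 1 0
    simp only [PiecewiseKolmogorov.h] at h0 h1; linarith
  have hβ : Z.β = 1 := by
    have h0 := hZ 0 0; have h1 := hZ 0 1
    simp only [PiecewiseKolmogorov.h] at h0 h1; linarith
  have hE : S.e * p.1 ≠ 0 := mul_ne_zero h.e_ne_zero hp1
  refine exists_isAdaptedIntegral h (fun q hX _ => hX)
    (fun q hq h1 => Prod.ext ((div_eq_one_iff_eq hp1).1 h1) (hl q hq))
    (fun q hq _ => ⟨?_, 1, one_pos, ?_⟩) (neg_ne_zero.2 hE) (mul_ne_zero h.snd_ne_zero hE)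
  · rw [← h.firstIntegral_horizontal, ← hl q hq]
  · have e : q.1 / p.1 * p.1 = q.1 := div_mul_cancel₀ _ hp1
    simp only [hα, hβ, field, hl q hq]
    linear_combination p.2 * h.snd_eq - p.2 * S.e * e

/-- On the vertical line through `p` the exponent is `expY`. -/
lemma exists_isAdaptedIntegral_vertical (h : S.IsCenterType p)
    (hZ : ∀ x y, Z.h x y = x - p.1) :
    ∃ U ∈ 𝓝 p, Z.IsAdaptedIntegral S p (fun q => q.2 / p.2) U S.expY (S.c * p.2)
      (p.1 * (S.c * p.2)) (S.firstIntegral p) := by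
  have hp2 := h.snd_ne_zero
  have hl : ∀ q ∈ Z.sepLine, q.1 = p.1 := fun q hq => sub_eq_zero.1 ((hZ _ _).symm.trans hq)
  have hα : Z.α = 1 := by
    have h0 := hZ 0 0; have h1 := hZ 1 0
    simp only [PiecewiseKolmogorov.h] at h0 h1; linarith
  have hβ : Z.β = 0 := by
    have h0 := hZ 0 0; have h1 := hZ 0 1
    simp only [PiecewiseKolmogorov.h] at h0 h1; linarith
  have hC : S.c * p.2 ≠ 0 := left_ne_zero_of_mul h.c_mul_e_ne_zero
  refine exists_isAdaptedIntegral h (fun q _ hY => hY)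
    (fun q hq h1 => Prod.ext (hl q hq) ((div_eq_one_iff_eq hp2).1 h1))
    (fun q hq _ => ⟨?_, 1, one_pos, ?_⟩) hC (mul_ne_zero h.fst_ne_zero hC)
  · rw [← h.firstIntegral_vertical, ← hl q hq]
  · have e : q.2 / p.2 * p.2 = q.2 := div_mul_cancel₀ _ hp2
    simp only [hα, hβ, field, hl q hq]
    linear_combination p.1 * h.fst_eq - p.1 * S.c * e

/-- On the line through `p` and the origin the exponent is `expX + expY`. -/
lemma exists_isAdaptedIntegral_diag (h : S.IsCenterType p)
    (hZ : ∀ x y, Z.h x y = x * p.2 - y * p.1) :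
    ∃ U ∈ 𝓝 p, Z.IsAdaptedIntegral S p (fun q => q.1 / p.1) U (S.expX + S.expY)
      (S.b * p.1 + S.c * p.2 - S.e * p.1 - S.f * p.2)
      (p.1 * p.2 * (S.b * p.1 + S.c * p.2 - S.e * p.1 - S.f * p.2)) (S.firstIntegral p) := by
  have hp1 := h.fst_ne_zero
  have hp2 := h.snd_ne_zero
  have e₁ : ∀ q : ℝ × ℝ, q.1 = p.1 * (q.1 / p.1) := fun q => (mul_div_cancel₀ _ hp1).symm
  have e₂ : ∀ q ∈ Z.sepLine, q.2 = p.2 * (q.1 / p.1) := fun q hq => by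
    have : q.1 * p.2 - q.2 * p.1 = 0 := (hZ _ _).symm.trans hq
    field_simp; linarith
  have hα : Z.α = p.2 := by
    have h0 := hZ 0 0; have h1 := hZ 1 0
    simp only [PiecewiseKolmogorov.h] at h0 h1; linarith
  have hβ : Z.β = -p.1 := by
    have h0 := hZ 0 0; have h1 := hZ 0 1
    simp only [PiecewiseKolmogorov.h] at h0 h1; linarith
  refine exists_isAdaptedIntegral h (fun q hX _ => hX)
    (fun q hq h1 => Prod.ext (by rw [e₁ q, h1, mul_one]) (by rw [e₂ q hq, h1, mul_one]))
    (fun q hq hpos => ⟨?_, q.1 / p.1, hpos, ?_⟩) h.diag_ne_zero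
    (mul_ne_zero (mul_ne_zero hp1 hp2) h.diag_ne_zero)
  · rw [← h.firstIntegral_diag hpos, ← e₁ q, ← e₂ q hq]
  · simp only [hα, hβ, field]
    have h1 := e₁ q
    have h2 := e₂ q hq
    set s := q.1 / p.1
    rw [h1, h2]
    linear_combination p.1 * p.2 * s * (h.fst_eq - h.snd_eq)

end PiecewiseKolmogorov

theorem theorem2 (Z : PiecewiseKolmogorov) (x₀ y₀ D₁ D₂ : ℝ)
    (hCC : Z.IsCCEquilibrium (x₀, y₀)) (hmono : Z.IsMonodromic (x₀, y₀))
    (hD₁ : (Z.Z₁.jac (x₀, y₀)).det = D₁ ^ 2) (hD₂ : (Z.Z₂.jac (x₀, y₀)).det = D₂ ^ 2) :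
    ((∀ x y : ℝ, Z.h x y = x * y₀ - y * x₀) →
      (Z.IsCenter (x₀, y₀) ↔
        D₁ ^ 2 * D₂ ^ 2 * (Z.Z₁.b * Z.Z₂.e - Z.Z₂.b * Z.Z₁.e)
          - x₀ ^ 2 * D₁ ^ 2 * Z.Z₂.b * Z.Z₁.e * (Z.Z₂.b - Z.Z₂.e) ^ 2
          + x₀ ^ 2 * D₂ ^ 2 * Z.Z₁.b * Z.Z₂.e * (Z.Z₁.b - Z.Z₁.e) ^ 2 = 0)) ∧
    ((∀ x y : ℝ, Z.h x y = y - y₀) →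
      (Z.IsCenter (x₀, y₀) ↔
        D₁ ^ 2 * Z.Z₂.b ^ 2 - D₁ ^ 2 * Z.Z₂.b * Z.Z₂.e
          - D₂ ^ 2 * Z.Z₁.b ^ 2 + D₂ ^ 2 * Z.Z₁.b * Z.Z₁.e = 0)) ∧
    ((∀ x y : ℝ, Z.h x y = x - x₀) →
      (Z.IsCenter (x₀, y₀) ↔
        D₁ ^ 2 * D₂ ^ 2 * (Z.Z₁.b * Z.Z₂.e - Z.Z₂.b * Z.Z₁.e)
          - x₀ ^ 2 * D₁ ^ 2 * Z.Z₂.b ^ 2 * Z.Z₁.e * (Z.Z₂.b - Z.Z₂.e)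
          + x₀ ^ 2 * D₂ ^ 2 * Z.Z₁.b ^ 2 * Z.Z₂.e * (Z.Z₁.b - Z.Z₁.e) = 0)) := by
  obtain ⟨hp, hc₁, hc₂⟩ := hCC
  have t₁ := hc₁.isCenterType
  have t₂ := hc₂.isCenterType
  have hx : x₀ ≠ 0 := t₁.fst_ne_zero
  have hy : y₀ ≠ 0 := t₁.snd_ne_zero
  have hd₁ : D₁ ^ 2 ≠ 0 := hD₁ ▸ hc₁.trace_eq_zero_and_det_pos.2.ne'
  have hd₂ : D₂ ^ 2 ≠ 0 := hD₂ ▸ hc₂.trace_eq_zero_and_det_pos.2.ne'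
  have he₁ := t₁.e_ne_zero
  have he₂ := t₂.e_ne_zero
  have x₁ := t₁.expX_formula
  have x₂ := t₂.expX_formula
  have y₁ := t₁.expY_formula
  have y₂ := t₂.expY_formula
  have s₁ := t₁.expX_add_expY_formula
  have s₂ := t₂.expX_add_expY_formula
  simp only [hD₁] at x₁ y₁ s₁
  simp only [hD₂] at x₂ y₂ s₂
  refine ⟨fun hh => ?_, fun hh => ?_, fun hh => ?_⟩
  -- In each case the points `p + s • v` of the line, with the factor `μ` of the normal velocity
  -- in `v`, are those near `p` where `Z₁` points out of its region.
  · obtain ⟨U₁, hU₁, a₁⟩ := PiecewiseKolmogorov.exists_isAdaptedIntegral_diag t₁ hh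
    obtain ⟨U₂, hU₂, a₂⟩ := PiecewiseKolmogorov.exists_isAdaptedIntegral_diag t₂ hh
    rw [PiecewiseKolmogorov.isCenter_iff_exponent_eq hp hmono (inter_mem hU₁ hU₂)
      (a₁.mono inter_subset_left) (a₂.mono inter_subset_right)
      (PiecewiseKolmogorov.frequently_of_ray (v := _ • (x₀, y₀))
        (smul_ne_zero a₁.μ_ne_zero (by simp [hx])) fun s hs => ⟨?_, ?_⟩)]
    · rw [← sub_eq_zero, ← mul_right_inj' (mul_ne_zero (mul_ne_zero hd₁ hd₂) (mul_ne_zero he₁ he₂)),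
        mul_zero, ← neg_eq_zero]
      refine Eq.congr_left ?_
      linear_combination -(D₂ ^ 2 * Z.Z₂.e) * s₁ + D₁ ^ 2 * Z.Z₁.e * s₂
    · refine (hh _ _).trans ?_
      simp; ring
    · have := a₁.μ_ne_zero
      generalize (x₀, y₀).1 * (x₀, y₀).2 * (Z.Z₁.b * (x₀, y₀).1 + Z.Z₁.c * (x₀, y₀).2
        - Z.Z₁.e * (x₀, y₀).1 - Z.Z₁.f * (x₀, y₀).2) = μ at *
      have : μ * ((((x₀, y₀) + s • μ • (x₀, y₀)).1) / x₀ - 1) = s * μ ^ 2 := by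
        simp; field_simp; ring
      rw [this]; positivity
  · obtain ⟨U₁, hU₁, a₁⟩ := PiecewiseKolmogorov.exists_isAdaptedIntegral_horizontal t₁ hh
    obtain ⟨U₂, hU₂, a₂⟩ := PiecewiseKolmogorov.exists_isAdaptedIntegral_horizontal t₂ hh
    rw [PiecewiseKolmogorov.isCenter_iff_exponent_eq hp hmono (inter_mem hU₁ hU₂)
      (a₁.mono inter_subset_left) (a₂.mono inter_subset_right)
      (PiecewiseKolmogorov.frequently_of_ray (v := _ • (x₀, 0))
        (smul_ne_zero a₁.μ_ne_zero (by simp [hx])) fun s hs => ⟨?_, ?_⟩)]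
    · rw [← sub_eq_zero, ← mul_right_inj' (mul_ne_zero hd₁ hd₂), mul_zero, ← neg_eq_zero]
      refine Iff.trans (Eq.congr_left ?_) (mul_eq_zero_iff_left (pow_ne_zero 2 hx))
      linear_combination -D₂ ^ 2 * x₁ + D₁ ^ 2 * x₂
    · refine (hh _ _).trans ?_
      simp
    · have := a₁.μ_ne_zero
      generalize (x₀, y₀).2 * (Z.Z₁.e * (x₀, y₀).1) = μ at *
      have : μ * ((((x₀, y₀) + s • μ • ((x₀, 0) : ℝ × ℝ)).1) / x₀ - 1) = s * μ ^ 2 := by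
        simp; field_simp; ring
      rw [this]; positivity
  · obtain ⟨U₁, hU₁, a₁⟩ := PiecewiseKolmogorov.exists_isAdaptedIntegral_vertical t₁ hh
    obtain ⟨U₂, hU₂, a₂⟩ := PiecewiseKolmogorov.exists_isAdaptedIntegral_vertical t₂ hh
    rw [PiecewiseKolmogorov.isCenter_iff_exponent_eq hp hmono (inter_mem hU₁ hU₂)
      (a₁.mono inter_subset_left) (a₂.mono inter_subset_right)
      (PiecewiseKolmogorov.frequently_of_ray (v := _ • (0, y₀))
        (smul_ne_zero a₁.μ_ne_zero (by simp [hy])) fun s hs => ⟨?_, ?_⟩)]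
    · rw [← sub_eq_zero, ← mul_right_inj' (mul_ne_zero (mul_ne_zero hd₁ hd₂) (mul_ne_zero he₁ he₂)),
        mul_zero, ← neg_eq_zero]
      refine Eq.congr_left ?_
      linear_combination -(D₂ ^ 2 * Z.Z₂.e) * y₁ + D₁ ^ 2 * Z.Z₁.e * y₂
    · refine (hh _ _).trans ?_
      simp
    · have := a₁.μ_ne_zero
      generalize (x₀, y₀).1 * (Z.Z₁.c * (x₀, y₀).2) = μ at *
      have : μ * ((((x₀, y₀) + s • μ • ((0, y₀) : ℝ × ℝ)).2) / y₀ - 1) = s * μ ^ 2 := by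
        simp; field_simp; ring
      rw [this]; positivity
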